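/- **Theorem.** Let $X,Y$ be Hilbert spaces (real or complex). For a linear operator $T$ from a subspace $D(T)\subseteq X$ into $Y$, write $R(T)$ and $N(T)$ for its range and null space. A number $K>0$ is a *Hyers–Ulam stability constant* of $T$ if for all $y\in R(T)$, $\varepsilon>0$ and $x\in D(T)$ with $\|Tx-y\|\le\varepsilon$ there is $x_0\in D(T)$ with $Tx_0=y$ and $\|x-x_0\|\le K\varepsilon$; $T$ has the *Hyers–Ulam stability* if such a $K$ exists, and $K_T$ denotes the infimum of all such $K$. A *bounded generalized inverse* of $T$ is a bounded linear operator $S:Y\to X$ with $R(S)\subseteq D(T)$, $TSTx=Tx$ for $x\in D(T)$, $STSy=Sy$ for $y\in Y$, and $ST$ continuous on $D(T)$. The *Moore–Penrose inverse* $T^\dagger$ of a closed densely defined $T$ is the operator with domain $R(T)+R(T)^\perp$ given by $T^\dagger y=(T|_{D(T)\cap N(T)^\perp})^{-1}Qy$, where $Q$ is the orthogonal projection of $Y$ onto $\overline{R(T)}$. Let $T$ be a closed densely defined linear operator from $X$ into $Y$ with the Hyers–Ulam stability, and let $T^+$ be a bounded generalized inverse of $T$. Let $\delta T$ be a linear operator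 from $X$ into $Y$ with $D(T)\subseteq D(\delta T)$ and $\|\delta T x\|\le a\|x\|+b\|Tx\|$ for all $x\in D(T)$, where $a,b\ge 0$ are constants with $$a\|T^+\|+b\|TT^+\|<1 .$$ Put $\overline T=T+\delta T$ with domain $D(T)$. Then $\overline T$ is closed and densely defined, $I+\delta T\,T^+$ is invertible in the bounded operators on $Y$, and with $B=T^+(I+\delta T\,T^+)^{-1}$ (so that $R(B)\subseteq D(\overline T)$) the following are equivalent: 1. $B$ is a bounded generalized inverse of $\overline T$; 2. $(I+\delta T\,T^+)^{-1}R(\overline T)=R(T)$; 3. $(I+\delta T\,T^+)^{-1}\overline T$ maps $N(T)$ into $R(T)$; 4. $R(\overline T)\cap N(T^+)=\{0\}$. Moreover, if one of these conditions holds, then $R(\overline T)$ is closed, $\overline T$ has the Hyers–Ulam stability, the operators $(B\overline T)^*$ and $(B\overline T)^{**}$ are everywhere defined and bounded on $X$, $\overline TB$ is bounded on $Y$, the two operators in braces below are invertible, $\overline T^\dagger$ is everywhere defined and bounded, and $K_{\overline T}=\|\overline T^\dagger\|$, where $$\overline T^\dagger=\{I-[(B\overline T)^{**}-(B\overline T)^*]^2\}^{-1}(B\overline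 T)^*\,B\,(\overline TB)^*\{I-[\overline TB-(\overline TB)^*]^2\}^{-1}.$$ -/

import Mathlib

namespace HyersUlam

variable {𝕜 X Y : Type*} [RCLike 𝕜]
  [NormedAddCommGroup X] [InnerProductSpace 𝕜 X]
  [NormedAddCommGroup Y] [InnerProductSpace 𝕜 Y]

/-- `T ∈ C(X, Y)`: a closed linear operator with dense domain. -/
structure IsClosedDenselyDefined (T : X →ₗ.[𝕜] Y) : Prop where
  isClosed : T.IsClosed
  dense : Dense (T.domain : Set X)

/-- The range `R(T)`. -/
def ran (T : X →ₗ.[𝕜] Y) : Submodule 𝕜 Y := LinearMap.range T.toFun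

/-- The null space `N(T)`, as a subspace of `X`. -/
def nul (T : X →ₗ.[𝕜] Y) : Submodule 𝕜 X := (LinearMap.ker T.toFun).map T.domain.subtype

/-- `K > 0` is a Hyers–Ulam stability constant for `T`. -/
def IsHUConstant (T : X →ₗ.[𝕜] Y) (K : ℝ) : Prop :=
  0 < K ∧ ∀ y ∈ ran T, ∀ ε : ℝ, 0 < ε → ∀ x : T.domain, ‖T x - y‖ ≤ ε →
    ∃ x₀ : T.domain, T x₀ = y ∧ ‖(x : X) - (x₀ : X)‖ ≤ K * ε

/-- `T` has the Hyers–Ulam stability. -/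
def HasHUStability (T : X →ₗ.[𝕜] Y) : Prop := ∃ K : ℝ, IsHUConstant T K

/-- `K_T`, the infimum of all Hyers–Ulam stability constants for `T`. -/
noncomputable def huConst (T : X →ₗ.[𝕜] Y) : ℝ := sInf {K : ℝ | IsHUConstant T K}

/-- `S ∈ B(Y, X)` is a (bounded) generalized inverse of `T`. -/
structure IsGeneralizedInverse (T : X →ₗ.[𝕜] Y) (S : Y →L[𝕜] X) : Prop where
  range_le : ∀ y, S y ∈ T.domain
  tst : ∀ x : T.domain, T ⟨S (T x), range_le _⟩ = T x
  sts : ∀ y, S (T ⟨S y, range_le y⟩) = S y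
  continuous : Continuous fun x : T.domain => S (T x)

/-- `P` is `T`-bounded with constants `a, b`. -/
structure IsRelBounded (P T : X →ₗ.[𝕜] Y) (a b : ℝ) : Prop where
  a_nonneg : 0 ≤ a
  b_nonneg : 0 ≤ b
  domain_le : T.domain ≤ P.domain
  bound : ∀ x : T.domain, ‖P ⟨x, domain_le x.2⟩‖ ≤ a * ‖(x : X)‖ + b * ‖T x‖

/-- The composition `T S`, for `S` defined everywhere with `R(S) ⊆ D(T)`. -/
def compLinear (T : X →ₗ.[𝕜] Y) (S : Y →L[𝕜] X) (hS : ∀ y, S y ∈ T.domain) : Y →ₗ[𝕜] Y :=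
  T.toFun ∘ₗ (S : Y →ₗ[𝕜] X).codRestrict T.domain hS

section Complete
variable [CompleteSpace X] [CompleteSpace Y]

/-- The composition `T S` as a bounded operator, for `T` closed and `S` bounded with
`R(S) ⊆ D(T)`; it is bounded by the closed graph theorem. -/
def compBounded (T : X →ₗ.[𝕜] Y) (hT : T.IsClosed) (S : Y →L[𝕜] X)
    (hS : ∀ y, S y ∈ T.domain) : Y →L[𝕜] Y where
  toLinearMap := compLinear T S hS
  cont := by
    apply LinearMap.continuous_of_isClosed_graph
    have h : ((compLinear T S hS).graph : Set (Y × Y)) =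
        (fun p : Y × Y => (S p.1, p.2)) ⁻¹' (T.graph : Set (X × Y)) := by
      ext ⟨y, z⟩
      simp only [SetLike.mem_coe, LinearMap.mem_graph_iff, Set.mem_preimage]
      constructor
      · rintro rfl
        exact T.mem_graph ⟨S y, hS y⟩
      · intro h
        obtain ⟨x, hx, hxz⟩ := (LinearPMap.mem_graph_iff T).1 h
        have : x = ⟨S y, hS y⟩ := Subtype.ext hx
        subst this
        exact hxz.symm
    rw [h]
    exact IsClosed.preimage (by fun_prop) hT

/-- The composition `P S` as a bounded operator, for `P` a `T`-bounded operator, `T` closed and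
`S` bounded with `R(S) ⊆ D(T) ⊆ D(P)`. -/
noncomputable def relCompBounded {P T : X →ₗ.[𝕜] Y} {a b : ℝ} (hP : IsRelBounded P T a b)
    (hT : T.IsClosed) (S : Y →L[𝕜] X) (hS : ∀ y, S y ∈ T.domain) : Y →L[𝕜] Y :=
  (compLinear P S (fun y => hP.domain_le (hS y))).mkContinuous
    (a * ‖S‖ + b * ‖compBounded T hT S hS‖) (fun y => by
      have h1 := hP.bound ⟨S y, hS y⟩
      have h2 := mul_le_mul_of_nonneg_left (S.le_opNorm y) hP.a_nonneg
      have h3 := mul_le_mul_of_nonneg_left ((compBounded T hT S hS).le_opNorm y) hP.b_nonneg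
      have h4 : (compBounded T hT S hS) y = T ⟨S y, hS y⟩ := rfl
      rw [h4] at h3
      have h5 : compLinear P S (fun y => hP.domain_le (hS y)) y
        = P ⟨S y, hP.domain_le (hS y)⟩ := rfl
      rw [h5]
      simp only at h1
      linarith)

end Complete

/-- The graph of the Moore–Penrose inverse of `T`: the pairs `(y, x)` with
`x ∈ D(T) ∩ N(T)ᗮ` and `T x = Q y`, where `Q` is the orthogonal projection of `Y` onto the
closure of `R(T)`. -/
def mpGraph [CompleteSpace Y] (T : X →ₗ.[𝕜] Y) : Submodule 𝕜 (Y × X) where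
  carrier := {p | p.2 ∈ (nul T)ᗮ ∧ (p.2, (ran T).topologicalClosure.starProjection p.1) ∈ T.graph}
  zero_mem' := by
    refine ⟨Submodule.zero_mem _, ?_⟩
    simp
  add_mem' := by
    rintro p q ⟨hp, hp'⟩ ⟨hq, hq'⟩
    refine ⟨Submodule.add_mem _ hp hq, ?_⟩
    simpa using T.graph.add_mem hp' hq'
  smul_mem' := by
    rintro c p ⟨hp, hp'⟩
    refine ⟨Submodule.smul_mem _ c hp, ?_⟩
    simpa using T.graph.smul_mem c hp'

/-- The Moore–Penrose inverse `T† y = (T|_{N(T)ᗮ})⁻¹ Q y`, as a partially defined operator. -/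
noncomputable def moorePenrose [CompleteSpace Y] (T : X →ₗ.[𝕜] Y) : Y →ₗ.[𝕜] X := (mpGraph T).toLinearPMap

/-- `mpGraph T` is the graph of a function, so it is the graph of `moorePenrose T`. -/
theorem graph_moorePenrose [CompleteSpace Y] (T : X →ₗ.[𝕜] Y) :
    (moorePenrose T).graph = mpGraph T := by
  apply Submodule.toLinearPMap_graph_eq
  rintro ⟨y, x⟩ ⟨hx, hxy⟩ (rfl : y = 0)
  simp only [map_zero] at hxy
  obtain ⟨x', rfl, hx'⟩ := (LinearPMap.mem_graph_iff T).1 hxy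
  have : (x' : X) ∈ nul T := ⟨x', hx', rfl⟩
  exact inner_self_eq_zero.1 (Submodule.inner_right_of_mem_orthogonal this hx)

/-- For closed `T` the domain of `T†` is `R(T) + R(T)ᗮ`. -/
theorem domain_moorePenrose [CompleteSpace X] [CompleteSpace Y] (T : X →ₗ.[𝕜] Y)
    (hT : T.IsClosed) : (moorePenrose T).domain = ran T ⊔ (ran T)ᗮ := by
  have hcl : IsClosed (nul T : Set X) := by
    have h : (nul T : Set X) = (fun x : X => (x, (0 : Y))) ⁻¹' (T.graph : Set (X × Y)) := by
      ext x
      constructor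
      · rintro ⟨z, hz, rfl⟩
        exact (LinearPMap.mem_graph_iff T).2 ⟨z, rfl, hz⟩
      · intro hx
        obtain ⟨z, hz, hz'⟩ := (LinearPMap.mem_graph_iff T).1 hx
        exact ⟨z, hz', hz⟩
    rw [h]
    exact IsClosed.preimage (by fun_prop) hT
  have : CompleteSpace (nul T) := hcl.completeSpace_coe
  ext y
  rw [LinearPMap.mem_domain_iff, graph_moorePenrose]
  constructor
  · rintro ⟨x, -, hx⟩
    obtain ⟨z, -, hz⟩ := (LinearPMap.mem_graph_iff T).1 hx
    have h1 := Submodule.sub_starProjection_mem_orthogonal (K := (ran T).topologicalClosure) y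
    rw [Submodule.orthogonal_closure] at h1
    rw [← add_sub_cancel ((ran T).topologicalClosure.starProjection y) y]
    exact Submodule.add_mem_sup ⟨z, hz⟩ h1
  · intro hy
    obtain ⟨_, ⟨z, rfl⟩, w, hw, rfl⟩ := Submodule.mem_sup.1 hy
    have hP : (nul T).starProjection (z : X) ∈ nul T := Submodule.starProjection_apply_mem _ _
    have hg : ((nul T).starProjection (z : X), (0 : Y)) ∈ T.graph := by
      obtain ⟨v, hv, hv'⟩ := hP
      exact (LinearPMap.mem_graph_iff T).2 ⟨v, hv', hv⟩
    refine ⟨z - (nul T).starProjection z, Submodule.sub_starProjection_mem_orthogonal _, ?_⟩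
    have h1 : (ran T).topologicalClosure.starProjection (T.toFun z + w) = T z := by
      rw [map_add, Submodule.starProjection_eq_self_iff.2
        ((ran T).le_topologicalClosure ⟨z, rfl⟩),
        (Submodule.starProjection_apply_eq_zero_iff _).2
          (by rwa [Submodule.orthogonal_closure]), add_zero]
      rfl
    simp only [h1]
    simpa using T.graph.sub_mem (T.mem_graph z) hg

end HyersUlam

/-!
Write `W = 1 + δT T⁺`, which is a Neumann perturbation of the identity, and `T̄ = T + δT`. Everything
rests on the decomposition `T̄ = W T + G` on `D(T)`, where `G = δT (1 - T⁺ T)` is bounded since `T`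
vanishes on `R(1 - T⁺ T)` and `T⁺ T` is bounded (`exists_add_eq`). It shows that a pair `(x, z)` is
in the graph of `T̄` exactly when `(x, W⁻¹ (z - G x))` is in the graph of `T`, so `T̄` is closed
without a separate bound on `b` (`IsClosedDenselyDefined.add`); it also shows that `B T̄` is
continuous on `D(T)`. With `T̄ T⁺ = W T T⁺`, the identity `B T̄ B = B` always holds, while
`T̄ B T̄ = T̄` says that `W⁻¹ T̄` takes values in `R(T) = R(T T⁺)`; the four conditions are
variants of this.

For the second part, let `S` be a generalized inverse of a closed densely defined `T`, let
`P = (S T)**` be the bounded extension of `S T`, and let `E = T S`. These are idempotents with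
`N(P) = N(T)` and `R(E) = R(T)`. For an idempotent `P` the orthogonal projection onto its range is
`P P* (1 - (P - P*)²)⁻¹`, and `1 - (P - P*)² = 1 + (P - P*)* (P - P*)` is invertible
(`starProjection_eq_of_idempotent`, `isUnit_one_sub_sub_adjoint_sq`). As `S = P S = S E`, the
operator in the theorem is `Q₁ S Q₂` with `Q₁`, `Q₂` the orthogonal projections onto `N(T)ᗮ` and
`R(T)`, which is the Moore–Penrose inverse (`IsGeneralizedInverse.formula_mem_mpGraph`). Finally,
correcting an approximate solution `x` of `T x = y` by `T† (T x - y)` shows that every positive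
`K ≥ ‖T†‖` is a stability constant, and approximate solutions `T† y` of `T x = 0`, orthogonal to
`N(T)`, show that no smaller one is (`huConst_eq_norm`).
-/

namespace HyersUlam

/-! ### Orthogonal projections onto ranges of idempotents -/

section StarRing
variable {R : Type*} [Ring R] [StarRing R] {p : R}

theorem one_sub_sub_star_sq_mul (hp : p * p = p) :
    (1 - (p - star p) ^ 2) * p = p * star p * p := by
  have hs : star p * star p = star p := by rw [← star_mul, hp]
  simp only [sq, sub_mul, mul_sub, one_mul, mul_assoc, hp, hs]
  abel

theorem mul_one_sub_sub_star_sq (hp : p * p = p) :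
    p * (1 - (p - star p) ^ 2) = p * star p * p := by
  have hs : star p * star p = star p := by rw [← star_mul, hp]
  have hp' : ∀ x, p * (p * x) = p * x := fun x => by rw [← mul_assoc, hp]
  simp only [sq, sub_mul, mul_sub, mul_one, mul_assoc, hp, hs, hp']
  abel

theorem star_mul_one_sub_sub_star_sq (hp : p * p = p) :
    star p * (1 - (p - star p) ^ 2) = star p * p * star p := by
  have h := mul_one_sub_sub_star_sq (p := star p) (by rw [← star_mul, hp])
  rwa [star_star, ← neg_sub p, neg_sq] at h

theorem commute_one_sub_sub_star_sq (hp : p * p = p) :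
    Commute (1 - (p - star p) ^ 2) (p * star p) := by
  have h := one_sub_sub_star_sq_mul (p := star p) (by rw [← star_mul, hp])
  rw [star_star, ← neg_sub p, neg_sq] at h
  change _ * (p * star p) = p * star p * _
  rw [← mul_assoc, one_sub_sub_star_sq_mul hp, mul_assoc p (star p) (_ - _),
    star_mul_one_sub_sub_star_sq hp]
  simp only [mul_assoc]

end StarRing

section Idempotent
variable {𝕜 E : Type*} [RCLike 𝕜] [NormedAddCommGroup E] [InnerProductSpace 𝕜 E] [CompleteSpace E]

/-- Since `P - P*` is skew-adjoint, `1 - (P - P*)² = 1 + (P - P*)* (P - P*)` is bounded below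
by `1`. -/
theorem isUnit_one_sub_sub_adjoint_sq (P : E →L[𝕜] E) :
    IsUnit (1 - (P - P.adjoint) ^ 2) := by
  refine ContinuousLinearMap.isUnit_of_forall_le_norm_inner_map _ (c := 1) one_pos fun x => ?_
  have hs : (P - P.adjoint).adjoint = -(P - P.adjoint) := by
    rw [map_sub, ContinuousLinearMap.adjoint_adjoint, neg_sub]
  have h : inner 𝕜 ((1 - (P - P.adjoint) ^ 2 : E →L[𝕜] E) x) x
      = ((‖x‖ ^ 2 + ‖(P - P.adjoint) x‖ ^ 2 : ℝ) : 𝕜) := by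
    have h1 : (1 - (P - P.adjoint) ^ 2 : E →L[𝕜] E) x
        = x + (P - P.adjoint).adjoint ((P - P.adjoint) x) := by
      rw [hs, sq]
      simp [sub_eq_add_neg]
    rw [h1, inner_add_left, ContinuousLinearMap.adjoint_inner_left,
      inner_self_eq_norm_sq_to_K, inner_self_eq_norm_sq_to_K]
    push_cast
    rfl
  rw [h, RCLike.norm_ofReal, NNReal.coe_one, mul_one, abs_of_nonneg (by positivity)]
  nlinarith [sq_nonneg ‖(P - P.adjoint) x‖]

/-- The orthogonal projection onto the range of an idempotent `P` is `P P* (1 - (P - P*)²)⁻¹`. -/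
theorem starProjection_eq_of_idempotent {P : E →L[𝕜] E} (hP : P * P = P)
    (K : Submodule 𝕜 E) [K.HasOrthogonalProjection] (hK : ∀ x, x ∈ K ↔ P x = x) :
    K.starProjection = P * P.adjoint * Ring.inverse (1 - (P - P.adjoint) ^ 2) := by
  set H := 1 - (P - P.adjoint) ^ 2 with hH
  have hU : IsUnit H := isUnit_one_sub_sub_adjoint_sq P
  have hadj : P.adjoint * (P * P.adjoint * Ring.inverse H) = P.adjoint := by
    have h : P.adjoint * H = P.adjoint * P * P.adjoint := star_mul_one_sub_sub_star_sq hP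
    rw [← mul_assoc, ← mul_assoc, ← h, Ring.mul_inverse_cancel_right _ _ hU]
  ext y
  refine Submodule.eq_starProjection_of_mem_of_inner_eq_zero ((hK _).2 ?_) fun w hw => ?_
  · change (P * (P * P.adjoint * Ring.inverse H)) y = _
    rw [← mul_assoc, ← mul_assoc, hP]
  · rw [← (hK w).1 hw, ← ContinuousLinearMap.adjoint_inner_left, map_sub]
    have := DFunLike.congr_fun hadj y
    rw [mul_apply_eq_comp] at this
    rw [this, sub_self, inner_zero_left]

/-- The form of `starProjection_eq_of_idempotent` with the inverse on the left: `P P*` commutes with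
`(P - P*)²`. -/
theorem starProjection_eq_of_idempotent' {P : E →L[𝕜] E} (hP : P * P = P)
    (K : Submodule 𝕜 E) [K.HasOrthogonalProjection] (hK : ∀ x, x ∈ K ↔ P x = x) :
    K.starProjection = Ring.inverse (1 - (P - P.adjoint) ^ 2) * (P * P.adjoint) := by
  have hU := isUnit_one_sub_sub_adjoint_sq P
  have hc : (1 - (P - P.adjoint) ^ 2) * (P * P.adjoint) =
      P * P.adjoint * (1 - (P - P.adjoint) ^ 2) := commute_one_sub_sub_star_sq hP
  rw [starProjection_eq_of_idempotent hP K hK,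
    ← Ring.inverse_mul_cancel_left _ (P * P.adjoint * Ring.inverse _) hU, ← mul_assoc _ (P * _),
    hc, Ring.mul_inverse_cancel_right _ _ hU]

end Idempotent

/-! ### The Moore–Penrose inverse and the Hyers–Ulam constant -/

section

variable {𝕜 X Y : Type*} [RCLike 𝕜]
  [NormedAddCommGroup X] [InnerProductSpace 𝕜 X]
  [NormedAddCommGroup Y] [InnerProductSpace 𝕜 Y]

theorem mem_nul_iff {T : X →ₗ.[𝕜] Y} (x : T.domain) : (x : X) ∈ nul T ↔ T x = 0 := by
  constructor
  · rintro ⟨z, hz, hzx⟩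
    rw [← Subtype.ext hzx]
    exact hz
  · exact fun h => ⟨x, h, rfl⟩

theorem mem_nul_iff_graph {T : X →ₗ.[𝕜] Y} (x : X) : x ∈ nul T ↔ (x, (0 : Y)) ∈ T.graph := by
  rw [LinearPMap.mem_graph_iff]
  exact ⟨fun ⟨z, hz, hzx⟩ => ⟨z, hzx, hz⟩, fun ⟨z, hzx, hz⟩ => ⟨z, hz, hzx⟩⟩

theorem isClosed_nul {T : X →ₗ.[𝕜] Y} (hT : T.IsClosed) : IsClosed (nul T : Set X) := by
  have h : (nul T : Set X) = (fun x : X => (x, (0 : Y))) ⁻¹' (T.graph : Set (X × Y)) :=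
    Set.ext mem_nul_iff_graph
  rw [h]
  exact IsClosed.preimage (by fun_prop) hT

section MoorePenrose
variable [CompleteSpace Y] {T : X →ₗ.[𝕜] Y} {F : Y →L[𝕜] X}

/-- A bounded operator whose graph lies in that of `T†` is `T†`, as it is defined on all of `Y`. -/
theorem moorePenrose_eq_toPMap (hF : ∀ y, (y, F y) ∈ mpGraph T) :
    moorePenrose T = (F : Y →ₗ[𝕜] X).toPMap ⊤ := by
  symm
  have hle : (F : Y →ₗ[𝕜] X).toPMap ⊤ ≤ moorePenrose T := by
    refine LinearPMap.le_of_le_graph ?_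
    rw [graph_moorePenrose]
    rintro ⟨y, x⟩ h
    obtain ⟨y', rfl, rfl⟩ := (LinearPMap.mem_graph_iff _).1 h
    exact hF _
  exact LinearPMap.eq_of_le_of_domain_eq hle (top_le_iff.1 hle.1).symm

/-- If `T†` is bounded with norm at most `K`, then `x - T† (T x - y)` is a solution of `T x₀ = y`
within `K ε` of `x`. -/
theorem isHUConstant_of_norm_le (hF : ∀ y, (y, F y) ∈ mpGraph T) {K : ℝ} (hK : 0 < K)
    (hFK : ‖F‖ ≤ K) : IsHUConstant T K := by
  refine ⟨hK, ?_⟩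
  rintro y hy ε hε x hxy
  have hr : T x - y ∈ ran T := (ran T).sub_mem ⟨x, rfl⟩ hy
  have h := (hF (T x - y)).2
  rw [Submodule.starProjection_eq_self_iff.2 ((ran T).le_topologicalClosure hr)] at h
  obtain ⟨z, hz, hTz⟩ := (LinearPMap.mem_graph_iff T).1 h
  refine ⟨x - z, ?_, ?_⟩
  · rw [LinearPMap.map_sub, hTz, sub_sub_cancel]
  · rw [AddSubgroupClass.coe_sub, sub_sub_cancel, hz]
    calc ‖F (T x - y)‖ ≤ ‖F‖ * ‖T x - y‖ := F.le_opNorm _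
      _ ≤ K * ε := by gcongr

/-- The stability condition for `T† y`, as an approximate solution of `T x = 0`, gives an element
`x₀` of `N(T)`; as `T† y` is orthogonal to `x₀`, its norm is at most `‖T† y - x₀‖`. -/
theorem norm_le_of_isHUConstant (hF : ∀ y, (y, F y) ∈ mpGraph T) {K : ℝ}
    (hK : IsHUConstant T K) : ‖F‖ ≤ K := by
  refine F.opNorm_le_bound hK.1.le fun y => ?_
  rcases eq_or_ne y 0 with rfl | hy
  · simp
  obtain ⟨x, hx, hTx⟩ := (LinearPMap.mem_graph_iff T).1 (hF y).2
  simp only at hx hTx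
  have hle : ‖T x - 0‖ ≤ ‖y‖ := by
    rw [sub_zero, hTx]
    exact Submodule.norm_starProjection_apply_le _ _
  obtain ⟨x₀, h0, hd⟩ := hK.2 0 (ran T).zero_mem ‖y‖ (norm_pos_iff.2 hy) x hle
  rw [hx] at hd
  refine le_trans ?_ hd
  have horth : inner 𝕜 (F y) (x₀ : X) = 0 :=
    Submodule.inner_left_of_mem_orthogonal ((mem_nul_iff x₀).2 h0) (hF y).1
  have hpyth := norm_sub_sq (𝕜 := 𝕜) (F y) (x₀ : X)
  rw [horth, map_zero, mul_zero, sub_zero] at hpyth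
  refine le_of_sq_le_sq ?_ (norm_nonneg _)
  rw [hpyth]
  nlinarith [sq_nonneg ‖(x₀ : X)‖]

theorem hasHUStability_of_mpGraph (hF : ∀ y, (y, F y) ∈ mpGraph T) : HasHUStability T :=
  ⟨‖F‖ + 1, isHUConstant_of_norm_le hF (by positivity) (by linarith)⟩

theorem huConst_eq_norm (hF : ∀ y, (y, F y) ∈ mpGraph T) : huConst T = ‖F‖ := by
  refine IsGLB.csInf_eq ⟨fun K hK => norm_le_of_isHUConstant hF hK, fun m hm => ?_⟩
    (hasHUStability_of_mpGraph hF)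
  -- when `F = 0` the norm itself is not a stability constant, but `‖F‖ + ε` always is
  refine le_of_forall_pos_le_add fun ε hε => ?_
  exact hm (isHUConstant_of_norm_le hF (by positivity) (by linarith))

end MoorePenrose

/-! ### The Moore–Penrose inverse in terms of a generalized inverse -/

section GeneralizedInverse
variable [CompleteSpace X] {T : X →ₗ.[𝕜] Y} {S : Y →L[𝕜] X}

/-- The closure of the densely defined bounded operator `S T`. -/
theorem IsGeneralizedInverse.exists_extension (hT : Dense (T.domain : Set X))
    (hS : IsGeneralizedInverse T S) : ∃ P : X →L[𝕜] X, ∀ x : T.domain, P x = S (T x) := by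
  let f : T.domain →L[𝕜] X := ⟨(S : Y →ₗ[𝕜] X) ∘ₗ T.toFun, hS.continuous⟩
  exact ⟨f.extend T.domain.subtypeL, fun x => f.extend_eq (e := T.domain.subtypeL)
    hT.denseRange_val isUniformEmbedding_subtype_val.isUniformInducing x⟩

omit [CompleteSpace X] in
theorem IsGeneralizedInverse.mem_nul_iff (hT : IsClosedDenselyDefined T)
    (hS : IsGeneralizedInverse T S) {P : X →L[𝕜] X} (hP : ∀ x : T.domain, P x = S (T x)) (x : X) :
    x ∈ nul T ↔ P x = 0 := by
  constructor
  · intro hx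
    obtain ⟨z, hz, rfl⟩ := hx
    have hz : T z = 0 := hz
    change P (z : X) = 0
    rw [hP, hz, map_zero]
  · -- `1 - P` maps the dense subspace `D(T)` into the closed subspace `N(T)`, hence all of `X`
    intro hx
    have h : ∀ z : X, z - P z ∈ nul T := by
      refine isClosed_property (p := fun z : X => z - P z ∈ nul T) hT.dense.denseRange_val
        ((isClosed_nul hT.isClosed).preimage (by fun_prop)) fun z => ?_
      refine ⟨z - ⟨S (T z), hS.range_le _⟩, ?_, ?_⟩
      · change T (z - ⟨S (T z), hS.range_le _⟩) = 0
        rw [LinearPMap.map_sub, hS.tst, sub_self]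
      · change (z : X) - S (T z) = _
        rw [hP]
    simpa [hx] using h x

/-- The adjoint of `S T` is the adjoint of its closure. -/
theorem IsGeneralizedInverse.adjoint_compPMap (hT : Dense (T.domain : Set X))
    {P : X →L[𝕜] X} (hP : ∀ x : T.domain, P x = S (T x)) :
    ((S : Y →ₗ[𝕜] X).compPMap T).adjoint = (P.adjoint : X →ₗ[𝕜] X).toPMap ⊤ := by
  have h : (S : Y →ₗ[𝕜] X).compPMap T = (P : X →ₗ[𝕜] X).toPMap T.domain :=
    LinearPMap.ext rfl fun x hx _ => (hP ⟨x, hx⟩).symm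
  rw [h]
  exact P.toPMap_adjoint_eq_adjoint_toPMap_of_dense hT

theorem adjoint_toPMap_top (P : X →L[𝕜] X) :
    ((P.adjoint : X →ₗ[𝕜] X).toPMap ⊤).adjoint = (P : X →ₗ[𝕜] X).toPMap ⊤ := by
  have h := P.adjoint.toPMap_adjoint_eq_adjoint_toPMap_of_dense (p := ⊤) dense_univ
  rwa [ContinuousLinearMap.adjoint_adjoint] at h

variable [CompleteSpace Y]

omit [CompleteSpace X] in
theorem IsGeneralizedInverse.mem_ran_iff (hT : T.IsClosed) (hS : IsGeneralizedInverse T S) (y : Y) :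
    y ∈ ran T ↔ compBounded T hT S hS.range_le y = y := by
  constructor
  · rintro ⟨x, rfl⟩
    exact hS.tst x
  · exact fun h => ⟨⟨S y, hS.range_le y⟩, h⟩

omit [CompleteSpace X] in
theorem IsGeneralizedInverse.isClosed_ran (hT : T.IsClosed) (hS : IsGeneralizedInverse T S) :
    IsClosed (ran T : Set Y) := by
  have h : (ran T : Set Y) = {y | compBounded T hT S hS.range_le y = y} :=
    Set.ext (hS.mem_ran_iff hT)
  rw [h]
  exact isClosed_eq (by fun_prop) continuous_id

/-- With `P = (S T)**` and `E = T S`, the formula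
`(1 - (P - P*)²)⁻¹ P* S E* (1 - (E - E*)²)⁻¹` is `Q₁ S Q₂`, for `Q₁` and `Q₂` the orthogonal
projections onto `N(T)ᗮ` and onto `R(T)`, because `S = P S = S E`. -/
theorem IsGeneralizedInverse.formula_mem_mpGraph (hT : IsClosedDenselyDefined T)
    (hS : IsGeneralizedInverse T S) {P : X →L[𝕜] X} (hP : ∀ x : T.domain, P x = S (T x))
    {E : Y →L[𝕜] Y} (hE : E = compBounded T hT.isClosed S hS.range_le) (y : Y) :
    (y, (Ring.inverse (1 - (P - P.adjoint) ^ 2) ∘L P.adjoint ∘L S ∘L E.adjoint ∘L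
      Ring.inverse (1 - (E - E.adjoint) ^ 2)) y) ∈ mpGraph T := by
  have hES : ∀ z, E z = T ⟨S z, hS.range_le z⟩ := fun z => by rw [hE]; rfl
  have hPS : ∀ z, P (S z) = S z := fun z =>
    (hP ⟨S z, hS.range_le z⟩).trans (hS.sts z)
  have hSE : ∀ z, S (E z) = S z := fun z => by rw [hES, hS.sts]
  have hEE : E * E = E := by
    ext z
    rw [mul_apply_eq_comp]
    exact (congrArg E (hES z)).trans
      ((hES _).trans (by rw [hS.tst, hES]))
  have hPP : P * P = P := by
    refine DFunLike.coe_injective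
      (Continuous.ext_on hT.dense (P * P).continuous P.continuous fun x hx => ?_)
    rw [mul_apply_eq_comp, hP ⟨x, hx⟩, hPS]
  -- the projection onto the range of `T`
  have hcl : (ran T).topologicalClosure = ran T :=
    (hS.isClosed_ran hT.isClosed).submodule_topologicalClosure_eq
  have hQ₂ : (ran T).topologicalClosure.starProjection =
      E * E.adjoint * Ring.inverse (1 - (E - E.adjoint) ^ 2) :=
    starProjection_eq_of_idempotent hEE _ fun z => by
      rw [hcl, hS.mem_ran_iff hT.isClosed, hE]
  -- the projection onto the orthogonal complement of the null space, which is the range of `P*`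
  have hP' : P.adjoint * P.adjoint = P.adjoint := by
    have := congrArg star hPP
    rwa [star_mul] at this
  have : CompleteSpace (nul T) := (isClosed_nul hT.isClosed).completeSpace_coe
  have hmem : ∀ x, x ∈ (nul T)ᗮ ↔ P.adjoint x = x := by
    intro x
    constructor
    · intro hx
      refine ext_inner_right 𝕜 fun w => ?_
      have hw : w - P w ∈ nul T := by
        rw [hS.mem_nul_iff hT hP, map_sub, ← mul_apply_eq_comp, hPP, sub_self]
      have h := Submodule.inner_left_of_mem_orthogonal hw hx
      rw [inner_sub_right, sub_eq_zero] at h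
      rw [ContinuousLinearMap.adjoint_inner_left, h]
    · intro hx
      rw [← hx, Submodule.mem_orthogonal]
      intro u hu
      rw [ContinuousLinearMap.adjoint_inner_right, (hS.mem_nul_iff hT hP u).1 hu, inner_zero_left]
  have hQ₁ : (nul T)ᗮ.starProjection =
      Ring.inverse (1 - (P - P.adjoint) ^ 2) * (P.adjoint * P) := by
    have h := starProjection_eq_of_idempotent' hP' (nul T)ᗮ hmem
    rwa [ContinuousLinearMap.adjoint_adjoint, ← neg_sub P, neg_sq] at h
  set Q₂ := (ran T).topologicalClosure.starProjection with hQ₂def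
  have hF : (Ring.inverse (1 - (P - P.adjoint) ^ 2) ∘L P.adjoint ∘L S ∘L E.adjoint ∘L
      Ring.inverse (1 - (E - E.adjoint) ^ 2)) y = (nul T)ᗮ.starProjection (S (Q₂ y)) := by
    rw [hQ₁, hQ₂]
    simp only [ContinuousLinearMap.comp_apply, mul_apply_eq_comp, hSE, hPS]
  rw [hF]
  refine ⟨Submodule.starProjection_apply_mem _ _, ?_⟩
  -- `T Q₁ S Q₂ y = T S Q₂ y = Q₂ y`
  have hker : S (Q₂ y) - (nul T)ᗮ.starProjection (S (Q₂ y)) ∈ nul T := by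
    have := Submodule.sub_starProjection_mem_orthogonal (K := (nul T)ᗮ) (S (Q₂ y))
    rwa [Submodule.orthogonal_orthogonal] at this
  have hSQ : (S (Q₂ y), Q₂ y) ∈ T.graph := by
    have hy : Q₂ y ∈ ran T := by
      rw [← hcl]
      exact Submodule.starProjection_apply_mem _ _
    have h := T.mem_graph ⟨S (Q₂ y), hS.range_le _⟩
    rw [← hES, hE, (hS.mem_ran_iff hT.isClosed _).1 hy] at h
    exact h
  simpa using T.graph.sub_mem hSQ ((mem_nul_iff_graph _).1 hker)

end GeneralizedInverse

end

/-! ### Relatively bounded perturbations -/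

section Perturbation
variable {𝕜 X Y : Type*} [RCLike 𝕜]
  [NormedAddCommGroup X] [InnerProductSpace 𝕜 X] [CompleteSpace X]
  [NormedAddCommGroup Y] [InnerProductSpace 𝕜 Y] [CompleteSpace Y]
  {T P : X →ₗ.[𝕜] Y} {S : Y →L[𝕜] X} {a b : ℝ}

omit [CompleteSpace X] in
theorem norm_relCompBounded_le (hP : IsRelBounded P T a b) (hT : T.IsClosed)
    (hS : ∀ y, S y ∈ T.domain) :
    ‖relCompBounded hP hT S hS‖ ≤ a * ‖S‖ + b * ‖compBounded T hT S hS‖ :=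
  LinearMap.mkContinuous_norm_le _ (add_nonneg (mul_nonneg hP.a_nonneg (norm_nonneg _))
    (mul_nonneg hP.b_nonneg (norm_nonneg _))) _

omit [CompleteSpace X] in
theorem isUnit_one_add_relCompBounded (hP : IsRelBounded P T a b) (hT : T.IsClosed)
    (hS : ∀ y, S y ∈ T.domain) (hab : a * ‖S‖ + b * ‖compBounded T hT S hS‖ < 1) :
    IsUnit (1 + relCompBounded hP hT S hS) := by
  rw [← sub_neg_eq_add]
  refine isUnit_one_sub_of_norm_lt_one ?_
  rw [norm_neg]
  exact (norm_relCompBounded_le hP hT hS).trans_lt hab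

omit [CompleteSpace X] [CompleteSpace Y] in
theorem IsRelBounded.domain_add (hP : IsRelBounded P T a b) : (T + P).domain = T.domain :=
  inf_eq_left.2 hP.domain_le

/-- The operator `P (1 - S T)` is bounded, because `P` is bounded by `a` on `N(T)`; the
identity is `T + P = (1 + P S) T + P (1 - S T)`. -/
theorem exists_add_eq (hT : IsClosedDenselyDefined T) (hP : IsRelBounded P T a b)
    (hS : IsGeneralizedInverse T S) : ∃ G : X →L[𝕜] Y, ∀ x : (T + P).domain,
      (T + P) x = (1 + relCompBounded hP hT.isClosed S hS.range_le) (T ⟨x, x.2.1⟩) + G x := by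
  obtain ⟨A, hA⟩ := hS.exists_extension hT.dense
  let g : T.domain →ₗ[𝕜] Y := P.toFun ∘ₗ
    (LinearMap.codRestrict P.domain (T.domain.subtype - (A : X →ₗ[𝕜] X) ∘ₗ T.domain.subtype)
      fun x => P.domain.sub_mem (hP.domain_le x.2) (by
        change A (x : X) ∈ _
        rw [hA]
        exact hP.domain_le (hS.range_le _)))
  have hg : ∀ x : T.domain, g x = P ⟨x, hP.domain_le x.2⟩ -
      P ⟨S (T x), hP.domain_le (hS.range_le _)⟩ := fun x => by
    rw [← LinearPMap.map_sub]
    change P _ = P _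
    congr 1
    refine Subtype.ext ?_
    change (x : X) - A x = x - S (T x)
    rw [hA]
  have hbound : ∀ x : T.domain, ‖g x‖ ≤ a * ‖1 - A‖ * ‖x‖ := fun x => by
    have h := hP.bound (x - ⟨S (T x), hS.range_le _⟩)
    rw [LinearPMap.map_sub, hS.tst, sub_self, norm_zero, mul_zero, add_zero] at h
    have h1 : ‖g x‖ ≤ a * ‖(x : X) - A x‖ := by
      rw [hg, ← LinearPMap.map_sub, hA]
      exact h
    refine h1.trans ?_
    rw [mul_assoc]
    exact mul_le_mul_of_nonneg_left ((1 - A).le_opNorm (x : X)) hP.a_nonneg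
  let g' : T.domain →L[𝕜] Y := g.mkContinuous _ hbound
  refine ⟨g'.extend T.domain.subtypeL, fun x => ?_⟩
  have hx : (g'.extend T.domain.subtypeL) (x : X) = g ⟨x, x.2.1⟩ :=
    g'.extend_eq (e := T.domain.subtypeL) hT.dense.denseRange_val
      isUniformEmbedding_subtype_val.isUniformInducing ⟨x, x.2.1⟩
  rw [hx, hg, LinearPMap.add_apply]
  change _ = T ⟨x, x.2.1⟩ + P ⟨S (T ⟨x, x.2.1⟩), _⟩ + _
  rw [add_assoc, add_sub_cancel]

omit [CompleteSpace X] [CompleteSpace Y] in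
/-- The pair `(x, z)` lies in the graph of `T + P = W T + G` if and only if `(x, W⁻¹ (z - G x))`
lies in the graph of `T`. -/
theorem IsClosedDenselyDefined.add (hT : IsClosedDenselyDefined T) (hP : IsRelBounded P T a b)
    {W : Y →L[𝕜] Y} (hW : IsUnit W) {G : X →L[𝕜] Y}
    (h : ∀ x : (T + P).domain, (T + P) x = W (T ⟨x, x.2.1⟩) + G x) :
    IsClosedDenselyDefined (T + P) := by
  have hl : ∀ y, Ring.inverse W (W y) = y := fun y =>
    DFunLike.congr_fun (Ring.inverse_mul_cancel W hW) y
  have hr : ∀ y, W (Ring.inverse W y) = y := fun y =>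
    DFunLike.congr_fun (Ring.mul_inverse_cancel W hW) y
  refine ⟨?_, by rw [hP.domain_add]; exact hT.dense⟩
  have hgr : ((T + P).graph : Set (X × Y)) =
      (fun p : X × Y => (p.1, Ring.inverse W (p.2 - G p.1))) ⁻¹' (T.graph : Set (X × Y)) := by
    ext ⟨x, z⟩
    simp only [SetLike.mem_coe, Set.mem_preimage, LinearPMap.mem_graph_iff]
    constructor
    · rintro ⟨x', rfl, rfl⟩
      exact ⟨⟨x', x'.2.1⟩, rfl, by rw [h, add_sub_cancel_right, hl]⟩
    · rintro ⟨x', rfl, hx'⟩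
      exact ⟨⟨x', x'.2, hP.domain_le x'.2⟩, rfl, by rw [h, hx', hr, sub_add_cancel]⟩
  unfold LinearPMap.IsClosed
  rw [hgr]
  exact hT.isClosed.preimage (by fun_prop)

end Perturbation

end HyersUlam

/-! ### Stability of the generalized inverse -/

open HyersUlam in
theorem theorem2p2 {𝕜 X Y : Type*} [RCLike 𝕜]
    [NormedAddCommGroup X] [InnerProductSpace 𝕜 X] [CompleteSpace X]
    [NormedAddCommGroup Y] [InnerProductSpace 𝕜 Y] [CompleteSpace Y]
    (T δT : X →ₗ.[𝕜] Y) (hT : IsClosedDenselyDefined T) (hHU : HasHUStability T)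
    (Tp : Y →L[𝕜] X) (hTp : IsGeneralizedInverse T Tp)
    (a b : ℝ) (hδ : IsRelBounded δT T a b)
    (hab : a * ‖Tp‖ + b * ‖compBounded T hT.isClosed Tp hTp.range_le‖ < 1) :
    let Tbar : X →ₗ.[𝕜] Y := T + δT
    let W : Y →L[𝕜] Y := 1 + relCompBounded hδ hT.isClosed Tp hTp.range_le
    let Winv : Y →L[𝕜] Y := Ring.inverse W
    let B : Y →L[𝕜] X := Tp ∘L Winv
    let c₁ : Prop := IsGeneralizedInverse Tbar B
    let c₂ : Prop := (ran Tbar).map (Winv : Y →ₗ[𝕜] Y) = ran T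
    let c₃ : Prop := ∀ x : Tbar.domain, (x : X) ∈ nul T → Winv (Tbar x) ∈ ran T
    let c₄ : Prop := ran Tbar ⊓ LinearMap.ker (Tp : Y →ₗ[𝕜] X) = ⊥
    IsUnit W ∧
    ∃ (hTbar : IsClosedDenselyDefined Tbar) (hB : ∀ y, B y ∈ Tbar.domain),
      List.TFAE [c₁, c₂, c₃, c₄] ∧
      (c₁ ∨ c₂ ∨ c₃ ∨ c₄ →
        IsClosed (ran Tbar : Set Y) ∧
        HasHUStability Tbar ∧
        -- `E = T̄ B`; `A = B T̄` on `D(T̄)`, with `A₁ = A*` and `A₂ = A**` bounded on all of `X`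
        let E : Y →L[𝕜] Y := compBounded Tbar hTbar.isClosed B hB
        let A : X →ₗ.[𝕜] X := (B : Y →ₗ[𝕜] X).compPMap Tbar
        ∃ A₁ A₂ : X →L[𝕜] X,
          A.adjoint = (A₁ : X →ₗ[𝕜] X).toPMap ⊤ ∧
          A.adjoint.adjoint = (A₂ : X →ₗ[𝕜] X).toPMap ⊤ ∧
          IsUnit (1 - (A₂ - A₁) ^ 2) ∧
          IsUnit (1 - (E - E.adjoint) ^ 2) ∧
          let F : Y →L[𝕜] X :=
            Ring.inverse (1 - (A₂ - A₁) ^ 2) ∘L A₁ ∘L B ∘L E.adjoint ∘L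
              Ring.inverse (1 - (E - E.adjoint) ^ 2)
          moorePenrose Tbar = (F : Y →ₗ[𝕜] X).toPMap ⊤ ∧
          huConst Tbar = ‖F‖) := by
  intro Tbar W Winv B c₁ c₂ c₃ c₄
  have hW : IsUnit W := isUnit_one_add_relCompBounded hδ hT.isClosed hTp.range_le hab
  have hl : ∀ y, Winv (W y) = y := fun y =>
    DFunLike.congr_fun (Ring.inverse_mul_cancel W hW) y
  have hr : ∀ y, W (Winv y) = y := fun y =>
    DFunLike.congr_fun (Ring.mul_inverse_cancel W hW) y
  obtain ⟨G, hG⟩ := exists_add_eq hT hδ hTp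
  have hdec : ∀ x : Tbar.domain, Tbar x = W (T ⟨x, x.2.1⟩) + G x := hG
  have hTbar : IsClosedDenselyDefined Tbar := hT.add hδ hW hG
  have hTpd : ∀ y, Tp y ∈ Tbar.domain := fun y =>
    ⟨hTp.range_le y, hδ.domain_le (hTp.range_le y)⟩
  -- `T̄ T⁺ = W T T⁺`, that is, `G` vanishes on the range of `T⁺`
  have hTTp : ∀ y, Tbar ⟨Tp y, hTpd y⟩ = W (T ⟨Tp y, hTp.range_le y⟩) := fun y => by
    change T ⟨Tp y, hTp.range_le y⟩ + δT _ =
      T ⟨Tp y, hTp.range_le y⟩ + δT ⟨Tp (T ⟨Tp y, hTp.range_le y⟩), _⟩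
    exact congrArg _ (congrArg δT (Subtype.ext (hTp.sts y).symm))
  have hker : ∀ y, Tp y = 0 → W y = y := fun y hy => by
    change y + δT ⟨Tp y, hδ.domain_le (hTp.range_le y)⟩ = y
    have h0 : (⟨Tp y, hδ.domain_le (hTp.range_le y)⟩ : δT.domain) = 0 := Subtype.ext hy
    rw [h0, LinearPMap.map_zero, add_zero]
  have hWTbar : ∀ x : Tbar.domain, Winv (Tbar x) = T ⟨x, x.2.1⟩ + Winv (G x) := fun x => by
    rw [hdec, map_add, hl]
  have hfix : ∀ {y}, y ∈ ran T → T ⟨Tp y, hTp.range_le y⟩ = y := by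
    rintro _ ⟨x, rfl⟩
    exact hTp.tst x
  have hB : ∀ y, B y ∈ Tbar.domain := fun y => hTpd _
  have hcont : Continuous fun x : Tbar.domain => B (Tbar x) := by
    have h : (fun x : Tbar.domain => B (Tbar x)) =
        fun x : Tbar.domain => Tp (T ⟨x, x.2.1⟩) + B (G x) := funext fun x => by
      change Tp (Winv (Tbar x)) = _ + Tp (Winv (G x))
      rw [hWTbar, map_add]
    rw [h]
    have h1 : Continuous fun x : Tbar.domain => (⟨x, x.2.1⟩ : T.domain) := by fun_prop
    have h2 := hTp.continuous.comp h1
    exact h2.add (by fun_prop)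
  have h23 : c₂ → c₃ := fun h x _ => h ▸ ⟨Tbar x, ⟨x, rfl⟩, rfl⟩
  have h31 : c₃ → c₁ := by
    intro h
    -- `x - T⁺ T x` lies in the null space of `T`
    have hmem : ∀ x : Tbar.domain, Winv (Tbar x) ∈ ran T := fun x => by
      have h1 := h (x - ⟨Tp (T ⟨x, x.2.1⟩), hTpd _⟩) ⟨⟨x, x.2.1⟩ - ⟨Tp (T ⟨x, x.2.1⟩),
        hTp.range_le _⟩, by
          change T _ = 0
          rw [LinearPMap.map_sub, hTp.tst, sub_self], rfl⟩
      rw [LinearPMap.map_sub, hTTp, map_sub, hl] at h1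
      exact ((ran T).sub_mem_iff_left ⟨_, rfl⟩).1 h1
    refine ⟨hB, fun x => ?_, fun y => ?_, hcont⟩
    · refine (hTTp (Winv (Tbar x))).trans ?_
      rw [hfix (hmem x), hr]
    · change Tp (Winv (Tbar ⟨Tp (Winv y), _⟩)) = Tp (Winv y)
      rw [hTTp, hl, hTp.sts]
  have h12 : c₁ → c₂ := by
    intro h
    refine le_antisymm ?_ ?_
    · rintro _ ⟨_, ⟨x, rfl⟩, rfl⟩
      have h1 : W (T ⟨Tp (Winv (Tbar x)), _⟩) = Tbar x :=
        (hTTp (Winv (Tbar x))).symm.trans (h.tst x)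
      change Winv (Tbar x) ∈ _
      rw [← h1, hl]
      exact ⟨_, rfl⟩
    · rintro y hy
      refine ⟨Tbar ⟨Tp y, hTpd y⟩, ⟨_, rfl⟩, ?_⟩
      change Winv _ = y
      rw [hTTp, hl, hfix hy]
  have h24 : c₂ → c₄ := by
    intro h
    refine (Submodule.eq_bot_iff _).2 ?_
    rintro y ⟨hy, hy0⟩
    have hy0 : Tp y = 0 := hy0
    have hyT : y ∈ ran T := by
      rw [← h]
      refine ⟨y, hy, ?_⟩
      change Winv y = y
      rw [← hker y hy0, hl, hker y hy0]
    have h0 : (⟨Tp y, hTp.range_le y⟩ : T.domain) = 0 := Subtype.ext hy0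
    rw [← hfix hyT, h0, LinearPMap.map_zero]
  have h43 : c₄ → c₃ := by
    intro h x _
    -- `u = (1 - T T⁺) W⁻¹ T̄ x` is annihilated by `T⁺`, so that `u = W u = T̄ (x - B T̄ x)`
    set v := Winv (Tbar x) with hv
    have hu0 : Tp (v - T ⟨Tp v, hTp.range_le v⟩) = 0 := by rw [map_sub, hTp.sts, sub_self]
    have hu : v - T ⟨Tp v, hTp.range_le v⟩ ∈ ran Tbar := by
      refine ⟨x - ⟨Tp v, hTpd v⟩, ?_⟩
      change Tbar _ = _
      rw [LinearPMap.map_sub, hTTp, ← hker _ hu0, map_sub, hv, hr]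
    have hz := (Submodule.eq_bot_iff _).1 h _ ⟨hu, hu0⟩
    rw [sub_eq_zero.1 hz]
    exact ⟨_, rfl⟩
  have htfae : List.TFAE [c₁, c₂, c₃, c₄] := by
    tfae_have 1 → 2 := h12
    tfae_have 2 → 3 := h23
    tfae_have 3 → 1 := h31
    tfae_have 2 → 4 := h24
    tfae_have 4 → 3 := h43
    tfae_finish
  refine ⟨hW, hTbar, hB, htfae, fun hc => ?_⟩
  have hc₁ : IsGeneralizedInverse Tbar B := by
    rcases hc with h | h | h | h
    exacts [h, h31 (h23 h), h31 h, h31 (h43 h)]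
  obtain ⟨A₂, hA₂⟩ := hc₁.exists_extension hTbar.dense
  have hF := hc₁.formula_mem_mpGraph hTbar hA₂ rfl
  have hadj := IsGeneralizedInverse.adjoint_compPMap (S := B) hTbar.dense hA₂
  refine ⟨hc₁.isClosed_ran hTbar.isClosed, hasHUStability_of_mpGraph hF, A₂.adjoint, A₂, hadj, ?_,
    isUnit_one_sub_sub_adjoint_sq A₂, isUnit_one_sub_sub_adjoint_sq _,
    moorePenrose_eq_toPMap hF, huConst_eq_norm hF⟩
  rw [hadj]
  exact adjoint_toPMap_top A₂
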